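/- For integers $m\ge 0$, $k\ge 1$ let $[k]=\{1,\dots,k\}$ and let the Sierpiński graph $S(m,k)$ have vertex set $[k]^m$, where $u$ and $v$ are adjacent iff there is a position $t$ with $u_i=v_i$ for $i<t$, $u_t\neq v_t$, and $u_j=v_t$, $v_j=u_t$ for all $j>t$. Its extreme vertices are the constant words $a\cdots a$ with $a\in[k]$. The graph $S^{++}(1,k)$ is the complete graph $K_{k+1}$, and for $n\ge 2$ the graph $S^{++}(n,k)$ consists of $k+1$ disjoint copies of $S(n-1,k)$, labelled by $0,1,\dots,k$, together with the following edges, which link distinct copies like the complete graph $K_{k+1}$: for any two distinct $a,b\in[k]$ the extreme vertex $b\cdots b$ of copy $a$ is joined to the extreme vertex $a\cdots a$ of copy $b$, and for each $a\in[k]$ the extreme vertex $a\cdots a$ of copy $0$ is joined to the extreme vertex $a\cdots a$ of copy $a$. Let $P_n(x)$ be the characteristic polynomial of the adjacency matrix of $S^{++}(n,k)$, let $f(x)=x^2+(2-k)x-k$, and let $f^j$ denote the $j$-fold composition of $f$ with itself, with $f^0(x)=x$. **Theorem.** Let $k\ge 1$ be an integer. Then $P_1(x)=(x-k)(x+1)^k$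 and, for all $n\ge 2$, $$P_n(x)=\bigl(x(x+2)\bigr)^{k^{n-2}\left(\binom k2-1\right)}\,P_{n-1}(f(x)),$$ which for $k=1$, where the exponent is $-1$, is an identity of rational functions. Moreover, for $n\ge 2$ the spectrum of $S^{++}(n,k)$ (the multiset of the eigenvalues of its adjacency matrix) consists of 1. $k$ with multiplicity $1$; 2. the zeros of $f^{n-1}(x)+1$, each with multiplicity $k$; 3. the zeros of $f^j(x)$, each with multiplicity $k^{n-2-j}\left(\binom k2-1\right)$, for $j=0,1,\dots,n-2$; 4. the zeros of $f^j(x)+2$, each with multiplicity $k^{n-2-j}\left(\binom k2-1\right)+1$, for $j=0,1,\dots,n-2$. Here zeros are complex zeros counted with their multiplicity as zeros, and the multiplicities of a number that occurs several times in the list are added (for $k=1$ the multiplicities in 3 are negative, and the sum is still meant algebraically): the multiplicity of every $z\in\mathbb C$ as an eigenvalue is the sum of its contributions from 1–4. If $k\ge 3$, the listed multiplicities are the exact multiplicities of the individual eigenvalues: $k$ is a simple eigenvalue, every zero of $f^{n-1}+1$ is an eigenvalue of multiplicity exactly $k$, and for $0\le j\le n-2$ every zero of $f^j$, respectively of $f^j+2$,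 is an eigenvalue of multiplicity exactly $k^{n-2-j}\left(\binom k2-1\right)$, respectively $k^{n-2-j}\left(\binom k2-1\right)+1$. -/

import Mathlib

open Polynomial

/-- The Sierpiński graph `S(n, k)` on the words of length `n` over a `k`-letter alphabet: `u` and
`v` are adjacent iff for some position `i` they agree before `i`, differ at `i`, and after `i` the
word `u` is constantly `v i` and the word `v` is constantly `u i`. -/
def sierpinskiGraph (n k : ℕ) : SimpleGraph (Fin n → Fin k) where
  Adj u v := ∃ i, (∀ j < i, u j = v j) ∧ u i ≠ v i ∧ ∀ j > i, u j = v i ∧ v j = u i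
  symm := ⟨by
    rintro u v ⟨i, h₁, h₂, h₃⟩
    exact ⟨i, fun j hj => (h₁ j hj).symm, h₂.symm, fun j hj => (h₃ j hj).symm⟩⟩
  loopless := ⟨by
    rintro u ⟨i, -, h, -⟩
    exact h rfl⟩

/-- The vertices of `S⁺⁺(n, k)`, `n ≥ 1`: the first component is the label of one of the `k + 1`
copies of `S(n - 1, k)` (the labels are the `k` letters and one extra label `none`), the second
component is a vertex of that copy. -/
abbrev SierpinskiPPVertex (n k : ℕ) : Type := Option (Fin k) × (Fin (n - 1) → Fin k)

/-- The edges of `S⁺⁺(n, k)` between distinct copies of `S(n - 1, k)`: for any two distinct letters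
`a`, `b`, the extreme vertex `b…b` of copy `a` is joined to the extreme vertex `a…a` of copy `b`;
and for any letter `a`, the extreme vertex `a…a` of the extra copy is joined to the extreme vertex
`a…a` of copy `a`. So any two distinct copies are joined by one edge, and (if `n ≥ 2`) no two of
these edges have a common end. -/
inductive SierpinskiPPLink (n k : ℕ) : SierpinskiPPVertex n k → SierpinskiPPVertex n k → Prop
  | letters (a b : Fin k) (h : a ≠ b) :
      SierpinskiPPLink n k (some a, fun _ => b) (some b, fun _ => a)
  | extra (a : Fin k) : SierpinskiPPLink n k (none, fun _ => a) (some a, fun _ => a)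
  | extra_symm (a : Fin k) : SierpinskiPPLink n k (some a, fun _ => a) (none, fun _ => a)

/-- The graph `S⁺⁺(n, k)` for `n ≥ 1`: `k + 1` disjoint copies of `S(n - 1, k)` whose extreme
vertices are linked like the complete graph `K_{k+1}`. For `n = 1` the copies are single vertices
and the graph is `K_{k+1}`, see `sierpinskiPP_one`. -/
def sierpinskiPP (n k : ℕ) : SimpleGraph (SierpinskiPPVertex n k) where
  Adj x y := (x.1 = y.1 ∧ (sierpinskiGraph (n - 1) k).Adj x.2 y.2) ∨ SierpinskiPPLink n k x y
  symm := ⟨by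
    rintro x y (⟨h, h'⟩ | h)
    · exact Or.inl ⟨h.symm, h'.symm⟩
    · right
      cases h with
      | letters a b h => exact .letters b a h.symm
      | extra a => exact .extra_symm a
      | extra_symm a => exact .extra a⟩
  loopless := ⟨by
    rintro ⟨c, u⟩ (⟨-, h⟩ | h)
    · exact (sierpinskiGraph (n - 1) k).loopless.irrefl _ h
    · cases h with
      | letters a _ h => exact h rfl⟩

/-- `S⁺⁺(1, k)` is the complete graph on its `k + 1` vertices. -/
theorem sierpinskiPP_one (k : ℕ) : sierpinskiPP 1 k = ⊤ := by
  ext ⟨c, u⟩ ⟨d, v⟩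
  have key : ∀ w : Fin (1 - 1) → Fin k, ∀ a : Fin k, w = fun _ => a :=
    fun w a => funext fun i => i.elim0
  have huv : u = v := funext fun i => i.elim0
  rw [SimpleGraph.top_adj]
  refine ⟨fun h => h.ne, fun h => Or.inr ?_⟩
  have hcd : c ≠ d := fun e => h (by rw [e, huv])
  rcases c with _ | a <;> rcases d with _ | b
  · exact absurd rfl hcd
  · rw [key u b, key v b]; exact .extra b
  · rw [key u a, key v a]; exact .extra_symm a
  · rw [key u b, key v a]; exact .letters a b (fun e => hcd (by rw [e]))

open Classical in
/-- The characteristic polynomial `det (x I - A)` of the adjacency matrix `A` of a finite graph. -/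
noncomputable def graphCharpoly {V : Type*} [Fintype V] (G : SimpleGraph V) : ℂ[X] :=
  (G.adjMatrix ℂ).charpoly

/-- The spectrum of a finite graph: the multiset of the eigenvalues of its adjacency matrix, i.e.
of the roots of the characteristic polynomial over `ℂ`, with their multiplicities. -/
noncomputable def graphSpectrum {V : Type*} [Fintype V] (G : SimpleGraph V) : Multiset ℂ :=
  (graphCharpoly G).roots

/-- The multiplicity of `z` as an eigenvalue of a finite graph (`0` if it is not an eigenvalue). -/
noncomputable def eigMult {V : Type*} [Fintype V] (G : SimpleGraph V) (z : ℂ) : ℕ :=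
  (graphSpectrum G).count z

/-- The polynomial `f(x) = x² + (2 - k) x - k`. -/
noncomputable def fPoly (k : ℕ) : ℂ[X] := X ^ 2 + C (2 - (k : ℂ)) * X - C (k : ℂ)

/-- The `j`-fold composition `f^j` of `f` with itself, `f^0(x) = x`. -/
noncomputable def fIter (k : ℕ) : ℕ → ℂ[X]
  | 0 => X
  | j + 1 => (fPoly k).comp (fIter k j)

/-- The integer `k^i (k(k-1)/2 - 1)`; it is negative for `k = 1`. -/
def sMult (k i : ℕ) : ℤ := (k : ℤ) ^ i * ((k.choose 2 : ℤ) - 1)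

/-! `S⁺⁺(n + 1, k)` arises from the `k`-regular graph `S⁺⁺(n, k)` by replacing every vertex by a
clique `K_k`: appending a letter to a vertex chooses one of its `k` darts. If `B` is the vertex-dart
incidence matrix and `T` reverses darts, the adjacency matrices are `A = B T Bᵀ` and `A' = Bᵀ B - 1
+ T`, with `B Bᵀ = k` and `T² = 1`. Inverting `x + 1 - T` and using `det (1 - UV) = det (1 - VU)` to
pass from darts to vertices turns `det (x - A')` into `det (f(x) - A)` times a power of `x (x + 2)`,
whose exponent is the number of edges minus the number of vertices (`charpoly_cliqueInsertion`).

Iterating from `K_{k+1}` gives a product over `f^j`; since `f - k = (x + 2)(x - k)`, the factor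
`f^(n-1) - k` telescopes and accounts for the extra `1` in item 4.

For `k ≥ 3` the set `(-∞, -2) ∪ [k, ∞)` is stable under `f`, avoids `0, -1, -2`, and contains
`f(0)`, `f(-2)` and the critical value of `f`. Hence the listed zeros are simple and the lists are
disjoint. -/

/-! ### Determinant of a clique insertion -/

section CliqueInsertion

/-- The permutation matrix of a map `T`. -/
def involutionMatrix {W : Type*} [DecidableEq W] (T : W → W) : Matrix W W ℂ :=
  Matrix.of fun w w' => if T w = w' then 1 else 0

theorem involutionMatrix_mul_self {W : Type*} [Fintype W] [DecidableEq W] {T : W → W}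
    (hT : Function.Involutive T) : involutionMatrix T * involutionMatrix T = 1 := by
  ext w w'
  rw [Matrix.mul_apply, Finset.sum_eq_single (T w)]
  · simp [involutionMatrix, Matrix.one_apply, hT w]
  · intro b _ hb
    simp [involutionMatrix, hb.symm]
  · simp

/-- An arbitrary numbering of the darts selects the smaller one of each pair `{w, T w}`. -/
theorem exists_orientation {W : Type*} [Fintype W] {T : W → W}
    (hT : Function.Involutive T) (hne : ∀ w, T w ≠ w) : ∃ p : W → Prop, ∀ w, p (T w) ↔ ¬ p w := by
  let e := Fintype.equivFin W
  refine ⟨fun w => e w < e (T w), fun w => ?_⟩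
  have : e (T w) ≠ e w := fun h => hne w (e.injective h)
  simp only [hT w]
  rw [not_lt]
  exact ⟨le_of_lt, fun h => lt_of_le_of_ne h this⟩

/-- Split by an orientation, the matrix has diagonal blocks `y` and off-diagonal blocks that are
mutually inverse permutation matrices up to sign; the Schur complement is `y - y⁻¹`. In the
application `M` is the number of edges. -/
theorem exists_det_scalar_sub_involutionMatrix {W : Type*} [Fintype W] [DecidableEq W] {T : W → W}
    (hT : Function.Involutive T) (hne : ∀ w, T w ≠ w) :
    ∃ M : ℕ, 2 * M = Fintype.card W ∧ ∀ y : ℂ, y ≠ 0 →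
      (y • (1 : Matrix W W ℂ) - involutionMatrix T).det = (y ^ 2 - 1) ^ M := by
  classical
  obtain ⟨p, hp⟩ := exists_orientation hT hne
  have hcard : Fintype.card {w // p w} = Fintype.card {w // ¬ p w} :=
    Fintype.card_congr ⟨fun w => ⟨T w, fun h => (hp w).1 h w.2⟩, fun w => ⟨T w, (hp w).2 w.2⟩,
      fun w => Subtype.ext (hT w), fun w => Subtype.ext (hT w)⟩
  refine ⟨Fintype.card {w // p w}, ?_, fun y hy => ?_⟩
  · have := Fintype.card_congr (Equiv.sumCompl p)
    rw [Fintype.card_sum] at this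
    omega
  have hne' : ∀ w w', (p w ↔ p w') → T w ≠ w' := by
    rintro w w' h rfl
    have := hp w
    tauto
  have h11 : (y • (1 : Matrix W W ℂ) - involutionMatrix T).toBlock p p = y • 1 := by
    ext w w'
    simp [involutionMatrix, Matrix.toBlock_apply, Matrix.one_apply, Subtype.ext_iff,
      hne' w w' (iff_of_true w.2 w'.2)]
  have h22 : (y • (1 : Matrix W W ℂ) - involutionMatrix T).toBlock (fun w => ¬ p w)
      (fun w => ¬ p w) = y • 1 := by
    ext w w'
    simp [involutionMatrix, Matrix.toBlock_apply, Matrix.one_apply, Subtype.ext_iff,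
      hne' w w' (iff_of_false w.2 w'.2)]
  have hmul : (y • (1 : Matrix W W ℂ) - involutionMatrix T).toBlock (fun w => ¬ p w) p *
      (y • (1 : Matrix W W ℂ) - involutionMatrix T).toBlock p (fun w => ¬ p w) = 1 := by
    ext w w'
    rw [Matrix.mul_apply, Finset.sum_eq_single ⟨T w, (hp w).2 w.2⟩]
    · have h1 : (w : W) ≠ T w := (hne w).symm
      have h2 : T w ≠ w' := by
        intro h
        exact w'.2 (h ▸ (hp w).2 w.2)
      simp [involutionMatrix, Matrix.toBlock_apply, Matrix.one_apply, Subtype.ext_iff,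
        h1, h2, hT (w : W)]
      split_ifs <;> simp
    · intro b _ hb
      have h1 : (w : W) ≠ b := fun h => w.2 (h ▸ b.2)
      have h2 : T w ≠ b := fun h => hb (Subtype.ext h.symm)
      simp [involutionMatrix, Matrix.toBlock_apply, Matrix.one_apply, h1, h2]
    · simp
  let _ : Invertible (y • (1 : Matrix {w // p w} {w // p w} ℂ)) :=
    ⟨y⁻¹ • 1, by simp [smul_smul, hy], by simp [smul_smul, hy]⟩
  have hinv : ⅟(y • (1 : Matrix {w // p w} {w // p w} ℂ)) = y⁻¹ • 1 := rfl
  rw [Matrix.det_toBlock _ p, h11, h22, Matrix.det_fromBlocks₁₁, hinv, Matrix.mul_smul,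
    Matrix.mul_one, Matrix.smul_mul, hmul, ← sub_smul, Matrix.det_smul, Matrix.det_smul,
    Matrix.det_one, Matrix.det_one, ← hcard, mul_one, mul_one, ← mul_pow]
  congr 1
  field_simp

/-- The characteristic polynomial of a clique insertion. The darts of a `k`-regular graph with
adjacency matrix `A` are indexed by `V × κ`, and `T` reverses them. -/
theorem charpoly_cliqueInsertion {V κ : Type*} [Fintype V] [DecidableEq V] [Fintype κ]
    [DecidableEq κ] {T : V × κ → V × κ} (hT : Function.Involutive T) (hne : ∀ w, T w ≠ w)
    (A : Matrix V V ℂ) (hA : ∀ v v', A v v' = ∑ a, if (T (v, a)).1 = v' then 1 else 0)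
    (A' : Matrix (V × κ) (V × κ) ℂ)
    (hA' : ∀ w w', A' w w' = (if w.1 = w'.1 then 1 else 0) - (if w = w' then 1 else 0) +
      if T w = w' then 1 else 0) :
    ∃ M : ℕ, 2 * M = Fintype.card V * Fintype.card κ ∧
      A'.charpoly * (X * (X + 2)) ^ Fintype.card V =
        (X * (X + 2)) ^ M * A.charpoly.comp (fPoly (Fintype.card κ)) := by
  obtain ⟨M, hM, hdet⟩ := exists_det_scalar_sub_involutionMatrix hT hne
  refine ⟨M, by rw [hM, Fintype.card_prod], ?_⟩
  let B : Matrix V (V × κ) ℂ := Matrix.of fun v w => if v = w.1 then 1 else 0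
  have hBB : B * B.transpose = (Fintype.card κ : ℂ) • 1 := by
    ext v v'
    by_cases h : v = v'
    · subst h
      simp [B, Matrix.mul_apply, Fintype.sum_prod_type]
    · have : ∀ x, v = x → ¬ v' = x := by rintro x rfl h'; exact h h'.symm
      simp [B, Matrix.mul_apply, Fintype.sum_prod_type, h]
  have hTB : ∀ w v', (involutionMatrix T * B.transpose) w v' = if (T w).1 = v' then 1 else 0 := by
    intro w v'
    rw [Matrix.mul_apply, Finset.sum_eq_single (T w)]
    · simp [B, involutionMatrix, eq_comm]
    · intro b _ hb
      simp [involutionMatrix, hb.symm]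
    · simp
  have hBTB : B * involutionMatrix T * B.transpose = A := by
    ext v v'
    rw [hA, Matrix.mul_assoc, Matrix.mul_apply, Fintype.sum_prod_type, Finset.sum_comm]
    refine Finset.sum_congr rfl fun a _ => ?_
    rw [Finset.sum_eq_single v] <;> simp +contextual [B, hTB, eq_comm]
  have hA'eq : A' = B.transpose * B - 1 + involutionMatrix T := by
    ext w w'
    rw [hA']
    simp [B, Matrix.mul_apply, involutionMatrix, Matrix.one_apply]
    simp only [eq_comm]
  apply Polynomial.eq_of_infinite_eval_eq
  -- Outside these three points both `x + 1` and `x (x + 2)` are invertible.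
  refine Set.Infinite.mono (s := ({0, -1, -2} : Set ℂ)ᶜ) ?_ (Set.Finite.infinite_compl (by simp))
  intro x hx
  simp only [Set.mem_compl_iff, Set.mem_insert_iff, Set.mem_singleton_iff, not_or] at hx
  obtain ⟨h0, h1, h2⟩ := hx
  have hy : x + 1 ≠ 0 := fun h => h1 (eq_neg_of_add_eq_zero_left h)
  have hx2 : x + 2 ≠ 0 := fun h => h2 (eq_neg_of_add_eq_zero_left h)
  set c : ℂ := x * (x + 2) with hc
  have hc0 : c ≠ 0 := mul_ne_zero h0 hx2
  have hcy : (x + 1) ^ 2 - 1 = c := by rw [hc]; ring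
  let S : Matrix (V × κ) (V × κ) ℂ := (x + 1) • 1 - involutionMatrix T
  -- `Q` is the inverse of `S`, because `T² = 1` gives `(x + 1 - T)(x + 1 + T) = (x + 1)² - 1 = c`.
  let Q : Matrix (V × κ) (V × κ) ℂ := c⁻¹ • ((x + 1) • 1 + involutionMatrix T)
  have hSQ : S * Q = 1 := by
    simp only [S, Q, Matrix.mul_smul, Matrix.sub_mul, Matrix.mul_add, Matrix.smul_mul,
      Matrix.one_mul, Matrix.mul_one, involutionMatrix_mul_self hT]
    rw [inv_smul_eq_iff₀ hc0, ← hcy]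
    module
  have hS : Matrix.scalar (V × κ) x - A' = S * (1 - Q * B.transpose * B) := by
    rw [Matrix.mul_sub, ← Matrix.mul_assoc, ← Matrix.mul_assoc, hSQ, hA'eq, Matrix.one_mul, Matrix.mul_one,
      Matrix.scalar_apply, ← Matrix.smul_one_eq_diagonal]
    simp only [S]
    module
  -- `B Q Bᵀ = c⁻¹ ((x + 1) k + A)`, and `c - (x + 1) k = f(x)`: this is where `f` comes from.
  have hV : 1 - B * (Q * B.transpose) =
      c⁻¹ • (Matrix.scalar V ((fPoly (Fintype.card κ)).eval x) - A) := by
    simp only [Q, Matrix.smul_mul, Matrix.mul_smul, Matrix.add_mul, Matrix.mul_add, Matrix.one_mul,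
      hBB, ← Matrix.mul_assoc, hBTB]
    rw [eq_inv_smul_iff₀ hc0, Matrix.scalar_apply, ← Matrix.smul_one_eq_diagonal, smul_sub,
      smul_inv_smul₀ hc0]
    simp only [fPoly, eval_sub, eval_add, eval_mul, eval_pow, eval_X, eval_C, hc]
    module
  have key : A'.charpoly.eval x = c ^ M * ((c⁻¹) ^ Fintype.card V *
      A.charpoly.eval ((fPoly (Fintype.card κ)).eval x)) := by
    rw [Matrix.eval_charpoly, Matrix.eval_charpoly, hS, Matrix.det_mul,
      Matrix.det_one_sub_mul_comm, hV, Matrix.det_smul, hdet _ hy, hcy]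
  simp only [Set.mem_ofPred_eq, eval_mul, eval_pow, eval_add, eval_X, eval_comp, eval_ofNat, key,
    ← hc]
  rw [inv_pow]
  field_simp

end CliqueInsertion

/-- `A + 1` is the all-ones matrix of rank one, so its known characteristic polynomial is evaluated
at `x + 1`. -/
theorem charpoly_adjMatrix_top {V : Type*} [Fintype V] [DecidableEq V] (k : ℕ)
    (h : Fintype.card V = k + 1) (A : Matrix V V ℂ)
    (hA : ∀ v w, A v w = if v = w then 0 else 1) :
    A.charpoly = (X - C (k : ℂ)) * (X + 1) ^ k := by
  refine Polynomial.funext fun x => ?_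
  have h1 := congrArg (Polynomial.eval (x + 1))
    (Matrix.charpoly_vecMulVec (fun _ : V => (1 : ℂ)) (fun _ => 1))
  have h2 : Matrix.scalar V x - A =
      Matrix.scalar V (x + 1) - Matrix.vecMulVec (fun _ : V => (1 : ℂ)) (fun _ => 1) := by
    ext v w
    by_cases hvw : v = w
    · subst hvw; simp [hA, Matrix.vecMulVec_apply]
    · simp [hA, Matrix.vecMulVec_apply, hvw]
  rw [Matrix.eval_charpoly] at h1 ⊢
  rw [h2, h1]
  simp [h, dotProduct]
  ring

/-! ### Algebra of `f` and its iterates -/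

theorem eval_fPoly (k : ℕ) (z : ℂ) : (fPoly k).eval z = z ^ 2 + (2 - k) * z - k := by
  simp [fPoly]

theorem eval_fIter_succ (k j : ℕ) (z : ℂ) :
    (fIter k (j + 1)).eval z = (fPoly k).eval ((fIter k j).eval z) := by
  simp [fIter, eval_comp]

theorem fIter_comp_fPoly (k j : ℕ) : (fIter k j).comp (fPoly k) = fIter k (j + 1) := by
  induction j with
  | zero => simp [fIter]
  | succ j ih => rw [fIter, comp_assoc, ih, ← fIter]

theorem natDegree_fPoly (k : ℕ) : (fPoly k).natDegree = 2 := by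
  rw [fPoly]; compute_degree!

theorem natDegree_fIter_pos (k j : ℕ) : 0 < (fIter k j).natDegree := by
  induction j with
  | zero => simp [fIter]
  | succ j ih => rw [fIter, natDegree_comp, natDegree_fPoly]; omega

theorem fIter_add_C_ne_zero (k j : ℕ) (c : ℂ) : fIter k j + C c ≠ 0 := by
  intro h
  have := natDegree_fIter_pos k j
  rw [← natDegree_add_C (a := c), h] at this
  simp at this

theorem fPoly_sub_C (k : ℕ) : fPoly k - C (k : ℂ) = (X + 2) * (X - C (k : ℂ)) := by
  refine Polynomial.funext fun z => ?_
  simp [fPoly]; ring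

/-- Substituting `f^n` into `f - k = (x + 2)(x - k)` makes the product telescope. -/
theorem fIter_sub_C (k n : ℕ) : fIter k n - C (k : ℂ) =
    (X - C (k : ℂ)) * ∏ j ∈ Finset.range n, (fIter k j + 2) := by
  induction n with
  | zero => simp [fIter]
  | succ n ih =>
    have := congrArg (fun p => p.comp (fIter k n)) (fPoly_sub_C k)
    simp only [sub_comp, C_comp, mul_comp, add_comp, X_comp, ofNat_comp] at this
    rw [fIter, this, ih, Finset.prod_range_succ]
    ring

/-! ### Real dynamics of `f`: simplicity and disjointness of the zeros -/

section Dynamics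

variable {k : ℕ}

/-- A set of real numbers that is stable under `f` and contains no target value. -/
def escapeSet (k : ℕ) : Set ℂ := {z | ∃ r : ℝ, (r < -2 ∨ (k : ℝ) ≤ r) ∧ z = r}

/-- `f(r) - k = (r + 2)(r - k)` is nonnegative there, so the image even lies in `[k, ∞)`. -/
theorem eval_fPoly_mem_escapeSet {z : ℂ} (hz : z ∈ escapeSet k) :
    (fPoly k).eval z ∈ escapeSet k := by
  obtain ⟨r, hr, rfl⟩ := hz
  refine ⟨r ^ 2 + (2 - k) * r - k, Or.inr ?_, by rw [eval_fPoly]; push_cast; ring⟩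
  have hk : (0 : ℝ) ≤ k := k.cast_nonneg
  have : 0 ≤ (r + 2) * (r - k) := by
    rcases hr with h | h
    · exact mul_nonneg_of_nonpos_of_nonpos (by linarith) (by linarith)
    · exact mul_nonneg (by linarith) (by linarith)
  nlinarith

theorem eval_fIter_mem_escapeSet {i j : ℕ} (hij : i < j) {z : ℂ}
    (h : (fPoly k).eval ((fIter k i).eval z) ∈ escapeSet k) :
    (fIter k j).eval z ∈ escapeSet k := by
  obtain ⟨d, rfl⟩ := Nat.exists_eq_add_of_lt hij
  clear hij
  induction d with
  | zero => rwa [add_zero, eval_fIter_succ]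
  | succ d ih => rw [← add_assoc, eval_fIter_succ]; exact eval_fPoly_mem_escapeSet ih

theorem ofReal_notMem_escapeSet {r : ℝ} (h1 : -2 ≤ r) (h2 : r < k) :
    (r : ℂ) ∉ escapeSet k := by
  rintro ⟨s, hs, h⟩
  rw [Complex.ofReal_inj] at h
  subst h
  rcases hs with hs | hs <;> linarith

theorem neg_notMem_escapeSet {c : ℂ} (hk : 1 ≤ k) (hc : c = 0 ∨ c = 1 ∨ c = 2) :
    -c ∉ escapeSet k := by
  have hk' : (1 : ℝ) ≤ k := by exact_mod_cast hk
  rcases hc with rfl | rfl | rfl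
  · have := ofReal_notMem_escapeSet (k := k) (r := 0) (by norm_num) (by linarith)
    simpa using this
  · have := ofReal_notMem_escapeSet (k := k) (r := -1) (by norm_num) (by linarith)
    simpa using this
  · have := ofReal_notMem_escapeSet (k := k) (r := -2) (by norm_num) (by linarith)
    simpa using this

theorem eval_fPoly_zero_mem (hk : 3 ≤ k) : (fPoly k).eval 0 ∈ escapeSet k := by
  have hk' : (3 : ℝ) ≤ k := by exact_mod_cast hk
  exact ⟨-k, Or.inl (by linarith), by rw [eval_fPoly]; push_cast; ring⟩

theorem eval_fPoly_neg_two_mem : (fPoly k).eval (-2) ∈ escapeSet k :=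
  ⟨k, Or.inr le_rfl, by rw [eval_fPoly]; push_cast; ring⟩

/-- The only critical point is `(k - 2) / 2`, with value `-k² / 4 - 1 < -2`. -/
theorem eval_fPoly_critical_mem (hk : 3 ≤ k) {z : ℂ} (hz : (derivative (fPoly k)).eval z = 0) :
    (fPoly k).eval z ∈ escapeSet k := by
  have hk' : (3 : ℝ) ≤ k := by exact_mod_cast hk
  have hz' : 2 * z + (2 - k) = 0 := by
    simpa [fPoly, one_add_one_eq_two] using hz
  have : z = (k - 2) / 2 := by linear_combination hz' / 2
  refine ⟨-(k : ℝ) ^ 2 / 4 - 1, Or.inl (by nlinarith), ?_⟩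
  rw [eval_fPoly, this]; push_cast; ring

/-- By the chain rule a vanishing derivative means that the orbit of `z` meets the critical point
before time `j`; from then on it stays in `escapeSet k`. -/
theorem eval_derivative_fIter_ne_zero (hk : 3 ≤ k) (j : ℕ) {z : ℂ}
    (hz : (fIter k j).eval z ∉ escapeSet k) : (derivative (fIter k j)).eval z ≠ 0 := by
  induction j with
  | zero => simp [fIter]
  | succ j ih =>
    rw [eval_fIter_succ] at hz
    rw [fIter, derivative_comp, eval_mul, eval_comp]
    exact mul_ne_zero (ih fun h => hz (eval_fPoly_mem_escapeSet h))
      fun h => hz (eval_fPoly_critical_mem hk h)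

theorem count_roots_fIter_add_C (hk : 3 ≤ k) (j : ℕ) {c : ℂ} (hc : c = 0 ∨ c = 1 ∨ c = 2) (z : ℂ)
    [Decidable ((fIter k j).eval z + c = 0)] :
    (fIter k j + C c).roots.count z = if (fIter k j).eval z + c = 0 then 1 else 0 := by
  have hne := fIter_add_C_ne_zero k j c
  rw [count_roots]
  split_ifs with h
  · have hz : (fIter k j).eval z ∉ escapeSet k := by
      rw [eq_neg_of_add_eq_zero_left h]
      exact neg_notMem_escapeSet (by omega) hc
    have h1 : 0 < (fIter k j + C c).rootMultiplicity z :=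
      (rootMultiplicity_pos hne).2 (by simpa using h)
    have h2 : ¬ 1 < (fIter k j + C c).rootMultiplicity z := by
      rw [one_lt_rootMultiplicity_iff_isRoot hne]
      rintro ⟨-, h⟩
      exact eval_derivative_fIter_ne_zero hk j hz (by simpa using h)
    omega
  · exact rootMultiplicity_eq_zero (by simpa using h)

/-- After visiting `0` or `-2` the orbit is trapped in `escapeSet k`, which contains none of `0, -1,
-2`. The bound `3 ≤ k` matters: for `k = 2`, `f(0) = -2`. -/
theorem eval_fIter_add_ne_zero_of_lt (hk : 3 ≤ k) {i j : ℕ} (hij : i < j) {z : ℂ} {c d : ℂ}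
    (hc : c = 0 ∨ c = 2) (hd : d = 0 ∨ d = 1 ∨ d = 2) (h : (fIter k i).eval z + c = 0) :
    (fIter k j).eval z + d ≠ 0 := by
  intro h'
  have := neg_notMem_escapeSet (k := k) (by omega) hd
  rw [← eq_neg_of_add_eq_zero_left h'] at this
  refine this (eval_fIter_mem_escapeSet hij ?_)
  rw [eq_neg_of_add_eq_zero_left h]
  rcases hc with rfl | rfl
  · simpa using eval_fPoly_zero_mem hk
  · exact eval_fPoly_neg_two_mem

theorem eval_fIter_natCast (j : ℕ) : (fIter k j).eval (k : ℂ) = k := by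
  induction j with
  | zero => simp [fIter]
  | succ j ih => rw [eval_fIter_succ, ih, eval_fPoly]; ring

end Dynamics

/-! ### Darts of `S⁺⁺(m + 1, k)` as vertices of `S⁺⁺(m + 2, k)` -/

section LabelledEdges

variable {k m : ℕ}

/-- The edge of `S(m, k)` from `u` to `v` leaves `u` through the corner `a` and enters `v` through
the corner `b`. -/
def InnerEdge (u : Fin m → Fin k) (a : Fin k) (v : Fin m → Fin k) (b : Fin k) : Prop :=
  ∃ i, (∀ j < i, u j = v j) ∧ u i ≠ v i ∧ (∀ j > i, u j = v i ∧ v j = u i) ∧ a = v i ∧ b = u i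

/-- The edge between the copies `c` and `d` joins the extreme vertex `a⋯a` of the copy `c` to the
extreme vertex `b⋯b` of the copy `d`. -/
def CopyEdge : Option (Fin k) → Fin k → Option (Fin k) → Fin k → Prop
  | some p, a, some q, b => p ≠ q ∧ a = q ∧ b = p
  | none, a, some q, b => a = q ∧ b = q
  | some p, a, none, b => a = p ∧ b = p
  | none, _, none, _ => False

/-- The edges of `S⁺⁺(m + 1, k)`, labelled by the corners at which they are attached to the cliques
that replace their ends in `S⁺⁺(m + 2, k)`. -/
def LabelledEdge (w w' : (Option (Fin k) × (Fin m → Fin k)) × Fin k) : Prop :=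
  (w.1.1 = w'.1.1 ∧ InnerEdge w.1.2 w.2 w'.1.2 w'.2) ∨
    (CopyEdge w.1.1 w.2 w'.1.1 w'.2 ∧ (w.1.2 = fun _ => w.2) ∧ w'.1.2 = fun _ => w'.2)

theorem InnerEdge.symm {u v : Fin m → Fin k} {a b : Fin k} (h : InnerEdge u a v b) :
    InnerEdge v b u a := by
  obtain ⟨i, h1, h2, h3, h4, h5⟩ := h
  exact ⟨i, fun j hj => (h1 j hj).symm, h2.symm, fun j hj => (h3 j hj).symm, h5, h4⟩

theorem CopyEdge.symm {c d : Option (Fin k)} {a b : Fin k} (h : CopyEdge c a d b) :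
    CopyEdge d b c a := by
  rcases c with _ | p <;> rcases d with _ | q <;> simp_all [CopyEdge]
  exact fun e => h.1 e.symm

theorem LabelledEdge.symm {w w' : (Option (Fin k) × (Fin m → Fin k)) × Fin k}
    (h : LabelledEdge w w') : LabelledEdge w' w :=
  h.imp (fun h => ⟨h.1.symm, h.2.symm⟩) fun h => ⟨h.1.symm, h.2.2, h.2.1⟩

theorem CopyEdge.ne {c d : Option (Fin k)} {a b : Fin k} (h : CopyEdge c a d b) : c ≠ d := by
  rcases c with _ | p <;> rcases d with _ | q <;> simp_all [CopyEdge]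

theorem CopyEdge.label_unique {c d : Option (Fin k)} {a b a' b' : Fin k} (h : CopyEdge c a d b)
    (h' : CopyEdge c a' d b') : a = a' := by
  rcases c with _ | p <;> rcases d with _ | q <;> simp_all [CopyEdge]

/-- The corners of a copy match the `k` other copies: corner `a` of copy `p` leads to copy `a` if `a
≠ p`, and to the extra copy if `a = p`; corner `a` of the extra copy leads to copy `a`. -/
theorem existsUnique_copyEdge (c : Option (Fin k)) (a : Fin k) :
    ∃ d b, CopyEdge c a d b ∧ ∀ d' b', CopyEdge c a d' b' → d' = d ∧ b' = b := by
  rcases c with _ | p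
  · refine ⟨some a, a, by simp [CopyEdge], ?_⟩
    rintro (_ | q) b' <;> simp +contextual [CopyEdge]
  · by_cases h : p = a
    · subst h
      refine ⟨none, p, by simp [CopyEdge], ?_⟩
      rintro (_ | q) b' <;> simp +contextual [CopyEdge]
    · refine ⟨some a, p, by simp [CopyEdge, h], ?_⟩
      rintro (_ | q) b' <;> simp +contextual [CopyEdge]
      rintro rfl; exact absurd rfl h

theorem InnerEdge.label_unique {u v : Fin m → Fin k} {a b a' b' : Fin k} (h : InnerEdge u a v b)
    (h' : InnerEdge u a' v b') : a = a' := by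
  obtain ⟨i, h1, h2, -, rfl, -⟩ := h
  obtain ⟨i', h1', h2', -, rfl, -⟩ := h'
  rcases lt_trichotomy i i' with hi | rfl | hi
  · exact absurd (h1' _ hi) h2
  · rfl
  · exact absurd (h1 _ hi) h2'

theorem InnerEdge.ne_const {u v : Fin m → Fin k} {a b : Fin k} (h : InnerEdge u a v b) :
    u ≠ fun _ => a := by
  obtain ⟨i, -, h2, -, rfl, -⟩ := h
  exact fun h => h2 (congrFun h i)

/-- The position of the edge must be the last one where `u` differs from `a`, and it determines `v`
and `b`. -/
theorem InnerEdge.end_unique {u v v' : Fin m → Fin k} {a b b' : Fin k} (h : InnerEdge u a v b)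
    (h' : InnerEdge u a v' b') : v = v' ∧ b = b' := by
  obtain ⟨i, h1, h2, h3, ha, rfl⟩ := h
  obtain ⟨i', h1', h2', h3', ha', rfl⟩ := h'
  have hi : i = i' := by
    rcases lt_trichotomy i i' with hi | rfl | hi
    · exact absurd (by rw [(h3 _ hi).1, ← ha, ha']) h2'
    · rfl
    · exact absurd (by rw [(h3' _ hi).1, ← ha', ha]) h2
  subst hi
  refine ⟨funext fun j => ?_, rfl⟩
  rcases lt_trichotomy j i with hj | rfl | hj
  · rw [← h1 j hj, h1' j hj]
  · rw [← ha, ha']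
  · rw [(h3 j hj).2, (h3' j hj).2]

theorem exists_innerEdge {u : Fin m → Fin k} {a : Fin k} (h : u ≠ fun _ => a) :
    ∃ v b, InnerEdge u a v b := by
  have hne : (Finset.univ.filter fun i => u i ≠ a).Nonempty := by
    obtain ⟨i, hi⟩ := Function.ne_iff.1 h
    exact ⟨i, by simpa using hi⟩
  obtain ⟨i, hi, hmax⟩ := Finset.exists_max_image _ id hne
  simp only [Finset.mem_filter, Finset.mem_univ, true_and, id] at hi hmax
  -- With `i` the last position where `u` differs from `a`, the neighbour turns `u_i a⋯a` into `a
  -- u_i⋯u_i`.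
  refine ⟨fun j => if j < i then u j else if j = i then a else u i, u i, i, ?_, ?_, ?_, ?_, rfl⟩
  · intro j hj
    simp [hj]
  · simpa using hi
  · intro j hj
    have : ¬ j < i := not_lt.2 (le_of_lt hj)
    refine ⟨?_, by simp [this, ne_of_gt hj]⟩
    by_contra hja
    exact absurd (hmax j (by simpa using hja)) (not_le.2 hj)
  · simp

/-- Every corner `a` of every vertex carries exactly one edge: it leaves the copy if the word is
`a⋯a` and stays inside otherwise. This defines the dart reversal. -/
theorem existsUnique_labelledEdge (w : (Option (Fin k) × (Fin m → Fin k)) × Fin k) :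
    ∃ w', LabelledEdge w w' ∧ ∀ w'', LabelledEdge w w'' → w'' = w' := by
  obtain ⟨⟨c, u⟩, a⟩ := w
  by_cases h : u = fun _ => a
  · obtain ⟨d, b, hdb, huniq⟩ := existsUnique_copyEdge c a
    refine ⟨((d, fun _ => b), b), Or.inr ⟨hdb, h, rfl⟩, ?_⟩
    rintro ⟨⟨d', v'⟩, b'⟩ (⟨-, h'⟩ | ⟨h1, -, h2⟩)
    · exact absurd h h'.ne_const
    · obtain ⟨rfl, rfl⟩ := huniq _ _ h1
      simp only at h2
      rw [h2]
  · obtain ⟨v, b, hvb⟩ := exists_innerEdge h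
    refine ⟨((c, v), b), Or.inl ⟨rfl, hvb⟩, ?_⟩
    rintro ⟨⟨d', v'⟩, b'⟩ (⟨h1, h'⟩ | ⟨-, h2, -⟩)
    · obtain ⟨rfl, rfl⟩ := hvb.end_unique h'
      simp only at h1
      rw [h1]
    · exact absurd h2 h

/-- Adjacent vertices are joined by a single dart in each direction, so counting darts gives a 0-1
adjacency matrix. -/
theorem LabelledEdge.label_unique {x y : Option (Fin k) × (Fin m → Fin k)} {a b a' b' : Fin k}
    (h : LabelledEdge (x, a) (y, b)) (h' : LabelledEdge (x, a') (y, b')) : a = a' := by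
  rcases h with ⟨h1, h2⟩ | ⟨h1, -⟩ <;> rcases h' with ⟨h1', h2'⟩ | ⟨h1', -⟩
  · exact h2.label_unique h2'
  · exact absurd h1 h1'.ne
  · exact absurd h1' h1.ne
  · exact h1.label_unique h1'

theorem sierpinskiPPLink_iff {n : ℕ} (x y : SierpinskiPPVertex n k) :
    SierpinskiPPLink n k x y ↔
      ∃ a b, CopyEdge x.1 a y.1 b ∧ (x.2 = fun _ => a) ∧ y.2 = fun _ => b := by
  constructor
  · rintro (⟨a, b, h⟩ | a | a)
    · exact ⟨b, a, ⟨h, rfl, rfl⟩, rfl, rfl⟩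
    · exact ⟨a, a, ⟨rfl, rfl⟩, rfl, rfl⟩
    · exact ⟨a, a, ⟨rfl, rfl⟩, rfl, rfl⟩
  · obtain ⟨c, u⟩ := x
    obtain ⟨d, v⟩ := y
    rintro ⟨a, b, h, rfl, rfl⟩
    rcases c with _ | p <;> rcases d with _ | q
    · exact h.elim
    · obtain ⟨rfl, rfl⟩ := h
      exact .extra _
    · obtain ⟨rfl, rfl⟩ := h
      exact .extra_symm _
    · obtain ⟨h, rfl, rfl⟩ := h
      exact .letters _ _ h

theorem sierpinskiPP_adj_iff (x y : SierpinskiPPVertex (m + 1) k) :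
    (sierpinskiPP (m + 1) k).Adj x y ↔ ∃ a b, LabelledEdge (m := m) (x, a) (y, b) := by
  change (_ ∧ _) ∨ _ ↔ _
  rw [sierpinskiPPLink_iff]
  constructor
  · rintro (⟨h, i, h1, h2, h3⟩ | ⟨a, b, h⟩)
    · exact ⟨y.2 i, x.2 i, Or.inl ⟨h, i, h1, h2, h3, rfl, rfl⟩⟩
    · exact ⟨a, b, Or.inr h⟩
  · rintro ⟨a, b, ⟨h, i, h1, h2, h3, -⟩ | h⟩
    · exact Or.inl ⟨h, i, h1, h2, h3⟩
    · exact Or.inr ⟨a, b, h⟩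

theorem snoc_eq_const_iff (u : Fin m → Fin k) (a b : Fin k) :
    (Fin.snoc u a : Fin (m + 1) → Fin k) = (fun _ => b) ↔ (u = fun _ => b) ∧ a = b := by
  simp [funext_iff, Fin.forall_fin_succ']

/-- If the words first differ at the last position, they share a clique; if earlier, the condition
on the last letters says exactly that they are the corner labels. -/
theorem sierpinskiGraph_snoc_adj_iff (u v : Fin m → Fin k) (a b : Fin k) :
    (sierpinskiGraph (m + 1) k).Adj (Fin.snoc u a) (Fin.snoc v b) ↔
      (u = v ∧ a ≠ b) ∨ InnerEdge u a v b := by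
  change (∃ i, _) ↔ _
  simp only [Fin.exists_fin_succ', Fin.forall_fin_succ', Fin.snoc_castSucc, Fin.snoc_last,
    gt_iff_lt, Fin.castSucc_lt_castSucc_iff, Fin.castSucc_lt_last, InnerEdge]
  have h0 : ∀ i : Fin m, ¬ Fin.last m < i.castSucc := fun i => not_lt.2 i.castSucc_lt_last.le
  simp [h0, funext_iff, or_comm]

/-- Appending a letter. -/
def sierpinskiPPEquiv (m k : ℕ) :
    (Option (Fin k) × (Fin m → Fin k)) × Fin k ≃ Option (Fin k) × (Fin (m + 1) → Fin k) where
  toFun w := (w.1.1, Fin.snoc w.1.2 w.2)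
  invFun x := ((x.1, Fin.init x.2), x.2 (Fin.last m))
  left_inv w := by simp
  right_inv x := by simp

theorem sierpinskiPP_succ_adj_iff (w w' : (Option (Fin k) × (Fin m → Fin k)) × Fin k) :
    (sierpinskiPP (m + 2) k).Adj (sierpinskiPPEquiv m k w) (sierpinskiPPEquiv m k w') ↔
      (w.1 = w'.1 ∧ w ≠ w') ∨ LabelledEdge w w' := by
  obtain ⟨⟨c, u⟩, a⟩ := w
  obtain ⟨⟨d, v⟩, b⟩ := w'
  change (_ ∧ _) ∨ _ ↔ _
  rw [sierpinskiPPLink_iff]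
  have key := sierpinskiGraph_snoc_adj_iff u v a b
  have hs := fun (u : Fin m → Fin k) => snoc_eq_const_iff u
  have hc : (∃ a' b', CopyEdge c a' d b' ∧ (Fin.snoc u a = fun _ : Fin (m + 1) => a') ∧
      Fin.snoc v b = fun _ : Fin (m + 1) => b') ↔
      CopyEdge c a d b ∧ (u = fun _ => a) ∧ v = fun _ => b := by
    simp only [hs]
    constructor
    · rintro ⟨_, _, h, ⟨hu, rfl⟩, hv, rfl⟩
      exact ⟨h, hu, hv⟩
    · rintro ⟨h, hu, hv⟩
      exact ⟨a, b, h, ⟨hu, rfl⟩, hv, rfl⟩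
  simp only [sierpinskiPPEquiv, Equiv.coe_fn_mk, LabelledEdge, Nat.add_one_sub_one] at *
  rw [hc, key]
  simp only [ne_eq, Prod.mk.injEq]
  tauto

end LabelledEdges

/-! ### Recursion and product formula for the characteristic polynomials -/

theorem graphCharpoly_eq_charpoly {V W : Type*} [Fintype V] [Fintype W] [DecidableEq W]
    (G : SimpleGraph V) (e : W ≃ V) (A : Matrix W W ℂ) (h1 : ∀ w w', G.Adj (e w) (e w') → A w w' = 1)
    (h0 : ∀ w w', ¬ G.Adj (e w) (e w') → A w w' = 0) : graphCharpoly G = A.charpoly := by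
  classical
  rw [graphCharpoly, ← Matrix.charpoly_reindex e A]
  congr 1
  · ext v w
    by_cases h : G.Adj v w
    · simp [h, h1]
    · simp [h, h0]

theorem graphCharpoly_sierpinskiPP_one (k : ℕ) :
    graphCharpoly (sierpinskiPP 1 k) = (X - C (k : ℂ)) * (X + 1) ^ k := by
  classical
  rw [graphCharpoly_eq_charpoly (sierpinskiPP 1 k) (Equiv.refl _)
    (Matrix.of fun v w => if v = w then 0 else 1)]
  · exact charpoly_adjMatrix_top k (by simp) _ fun v w => rfl
  · intro w w' h
    simpa using h.ne
  · intro w w' h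
    simpa [sierpinskiPP_one] using h

/-- Edges minus vertices: `(k + 1) k^m (k / 2 - 1) = k^m (k(k - 1) / 2 - 1)`. -/
theorem two_mul_edges_eq (k m M : ℕ) (hM : 2 * M = (k + 1) * k ^ m * k) :
    (M : ℤ) = sMult k m + ((k + 1) * k ^ m : ℕ) := by
  have h1 : (2 * M : ℚ) = (k + 1) * k ^ m * k := by exact_mod_cast hM
  have h2 := Nat.cast_choose_two ℚ k
  have : (M : ℚ) = k ^ m * ((k.choose 2 : ℕ) - 1) + (k + 1) * k ^ m := by
    rw [h2]; linear_combination h1 / 2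
  rw [sMult]
  have h3 : ((M : ℤ) : ℚ) = ((k ^ m * ((k.choose 2 : ℕ) - 1) + ((k + 1) * k ^ m : ℕ) : ℤ) : ℚ) := by
    push_cast; exact this
  exact_mod_cast h3

theorem graphCharpoly_sierpinskiPP_succ (m k : ℕ) :
    ∃ M : ℕ, (M : ℤ) = sMult k m + ((k + 1) * k ^ m : ℕ) ∧
      graphCharpoly (sierpinskiPP (m + 2) k) * (X * (X + 2)) ^ ((k + 1) * k ^ m) =
        (X * (X + 2)) ^ M * (graphCharpoly (sierpinskiPP (m + 1) k)).comp (fPoly k) := by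
  classical
  choose T hT hT' using existsUnique_labelledEdge (k := k) (m := m)
  -- `T` sends a dart to its reverse; symmetry and uniqueness of labelled edges make it an
  -- involution.
  have hinv : Function.Involutive T := fun w => (hT' _ _ (hT w).symm).symm
  have hadj : ∀ w, (sierpinskiPP (m + 1) k).Adj w.1 (T w).1 := fun w =>
    (sierpinskiPP_adj_iff _ _).2 ⟨_, _, hT w⟩
  have hne1 : ∀ w, w.1 ≠ (T w).1 := fun w => (hadj w).ne
  have hne : ∀ w, T w ≠ w := fun w h => hne1 w (by rw [h])
  let A : Matrix (SierpinskiPPVertex (m + 1) k) (SierpinskiPPVertex (m + 1) k) ℂ :=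
    Matrix.of fun v v' => ∑ a, if (T (v, a)).1 = v' then 1 else 0
  let A' : Matrix (SierpinskiPPVertex (m + 1) k × Fin k) (SierpinskiPPVertex (m + 1) k × Fin k) ℂ :=
    Matrix.of fun w w' => (if w.1 = w'.1 then 1 else 0) - (if w = w' then 1 else 0) +
      if T w = w' then 1 else 0
  obtain ⟨M, hM, h⟩ := charpoly_cliqueInsertion hinv hne A (fun _ _ => rfl) A' fun _ _ => rfl
  have hcard : Fintype.card (Option (Fin k) × (Fin m → Fin k)) = (k + 1) * k ^ m := by simp
  rw [hcard, Fintype.card_fin] at hM h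
  refine ⟨M, two_mul_edges_eq k m M hM, ?_⟩
  rw [graphCharpoly_eq_charpoly _ (sierpinskiPPEquiv m k) A',
    graphCharpoly_eq_charpoly (sierpinskiPP (m + 1) k) (Equiv.refl _) A, h]
  · intro v v' hv
    obtain ⟨a, b, hab⟩ := (sierpinskiPP_adj_iff _ _).1 hv
    have hTa : T (v, a) = (v', b) := (hT' _ _ hab).symm
    change (∑ a, if (T (v, a)).1 = v' then (1 : ℂ) else 0) = 1
    rw [Finset.sum_eq_single a]
    · simp [hTa]
    · intro a' _ ha'
      rw [if_neg]
      intro h'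
      have hlab := hT (v, a')
      rw [show T (v, a') = (v', (T (v, a')).2) from Prod.ext h' rfl] at hlab
      exact ha' (hlab.label_unique hab)
    · simp
  · intro v v' hv
    change (∑ a, if (T (v, a)).1 = v' then (1 : ℂ) else 0) = 0
    refine Finset.sum_eq_zero fun a _ => if_neg ?_
    rintro rfl
    exact hv (hadj (v, a))
  · intro w w' hw
    rw [sierpinskiPP_succ_adj_iff] at hw
    rcases hw with ⟨h1, h2⟩ | hw
    · have : T w ≠ w' := fun h' => hne1 w (by rw [h', h1])
      simp [A', h1, h2, this]
    · have : T w = w' := (hT' _ _ hw).symm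
      subst this
      simp [A', hne1 w, (hne w).symm]
  · intro w w' hw
    rw [sierpinskiPP_succ_adj_iff, not_or, not_and, not_not] at hw
    have h1 : T w ≠ w' := fun h' => hw.2 (h' ▸ hT w)
    by_cases h2 : w.1 = w'.1
    · have := hw.1 h2
      simp [A', this]
      exact fun h3 => absurd (this ▸ h3) h1
    · have : w ≠ w' := fun h' => h2 (by rw [h'])
      simp [A', h1, h2, this]

/-- The recursion unrolled, with the vertex-count powers kept on the left so that all exponents are
natural numbers, also for `k = 1`. -/
theorem graphCharpoly_sierpinskiPP_prod (k : ℕ) : ∃ M : ℕ → ℕ,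
    (∀ i, (M i : ℤ) = sMult k i + ((k + 1) * k ^ i : ℕ)) ∧
    ∀ m, graphCharpoly (sierpinskiPP (m + 1) k) *
        ∏ j ∈ Finset.range m, (fIter k j * (fIter k j + 2)) ^ ((k + 1) * k ^ (m - (j + 1))) =
      (∏ j ∈ Finset.range m, (fIter k j * (fIter k j + 2)) ^ M (m - (j + 1))) *
        ((fIter k m - C (k : ℂ)) * (fIter k m + 1) ^ k) := by
  choose M hM h using fun m => graphCharpoly_sierpinskiPP_succ m k
  refine ⟨M, hM, fun m => ?_⟩
  induction m with
  | zero => simp [graphCharpoly_sierpinskiPP_one, fIter]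
  | succ m ih =>
    -- Composing with `f` shifts every index `j` to `j + 1`; the recursion supplies the new factor
    -- at `j = 0`.
    have ih' := congrArg (fun p => p.comp (fPoly k)) ih
    simp only [mul_comp, prod_comp, pow_comp, add_comp, sub_comp, C_comp, one_comp, ofNat_comp,
      fIter_comp_fPoly] at ih'
    have hm := h m
    simp only [Finset.prod_range_succ', Nat.add_sub_add_right,
      Nat.sub_zero]
    rw [show fIter k 0 = X from rfl]
    linear_combination (∏ j ∈ Finset.range m,
      (fIter k (j + 1) * (fIter k (j + 1) + 2)) ^ ((k + 1) * k ^ (m - (j + 1)))) * hm +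
      (X * (X + 2)) ^ M m * ih'

/-! ### Root multiplicities and the spectrum -/

theorem count_roots_mul {p q : ℂ[X]} (hp : p ≠ 0) (hq : q ≠ 0) (z : ℂ) :
    (p * q).roots.count z = p.roots.count z + q.roots.count z := by
  rw [roots_mul (mul_ne_zero hp hq), Multiset.count_add]

theorem count_roots_prod {ι : Type*} (s : Finset ι) (p : ι → ℂ[X]) (h : ∀ i ∈ s, p i ≠ 0)
    (z : ℂ) : (∏ i ∈ s, p i).roots.count z = ∑ i ∈ s, (p i).roots.count z := by
  rw [roots_prod p s (Finset.prod_ne_zero_iff.2 h), Multiset.count_bind]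
  rfl

theorem graphCharpoly_ne_zero {V : Type*} [Fintype V] (G : SimpleGraph V) :
    graphCharpoly G ≠ 0 := by
  classical
  exact (Matrix.charpoly_monic _).ne_zero

theorem eigMult_sierpinskiPP (k m : ℕ) (z : ℂ) :
    (eigMult (sierpinskiPP (m + 1) k) z : ℤ) =
      (({(k : ℂ)} : Multiset ℂ).count z : ℤ) + (k : ℤ) * ((fIter k m + 1).roots.count z : ℤ) +
      ∑ j ∈ Finset.range m, sMult k (m - (j + 1)) * ((fIter k j).roots.count z : ℤ) +
      ∑ j ∈ Finset.range m, (sMult k (m - (j + 1)) + 1) * ((fIter k j + 2).roots.count z : ℤ) := by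
  obtain ⟨M, hM, h⟩ := graphCharpoly_sierpinskiPP_prod k
  have h0 : ∀ j, fIter k j ≠ 0 := fun j => by simpa using fIter_add_C_ne_zero k j 0
  have h1 : ∀ j, fIter k j + 1 ≠ 0 := fun j => by simpa using fIter_add_C_ne_zero k j 1
  have h2 : ∀ j, fIter k j + 2 ≠ 0 := fun j => fIter_add_C_ne_zero k j 2
  have h3 : ∀ j, fIter k j * (fIter k j + 2) ≠ 0 := fun j => mul_ne_zero (h0 j) (h2 j)
  have hX : X - C (k : ℂ) ≠ 0 := X_sub_C_ne_zero _
  have hp : ∀ N : ℕ → ℕ, (∏ j ∈ Finset.range m, (fIter k j * (fIter k j + 2)) ^ N j) ≠ 0 :=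
    fun N => Finset.prod_ne_zero_iff.2 fun j _ => pow_ne_zero _ (h3 j)
  have hcp : ∀ N : ℕ → ℕ, (∏ j ∈ Finset.range m, (fIter k j * (fIter k j + 2)) ^ N j).roots.count z
      = ∑ j ∈ Finset.range m, N j * ((fIter k j).roots.count z + (fIter k j + 2).roots.count z) := by
    intro N
    rw [count_roots_prod _ _ fun j _ => pow_ne_zero _ (h3 j)]
    refine Finset.sum_congr rfl fun j _ => ?_
    rw [roots_pow, Multiset.count_nsmul, count_roots_mul (h0 j) (h2 j)]
  have hcount := congrArg (fun p => p.roots.count z) (h m)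
  have hq : ∏ j ∈ Finset.range m, (fIter k j + 2) ≠ 0 :=
    Finset.prod_ne_zero_iff.2 fun j _ => h2 j
  rw [count_roots_mul (graphCharpoly_ne_zero _) (hp _), fIter_sub_C,
    count_roots_mul (hp _) (mul_ne_zero (mul_ne_zero hX hq) (pow_ne_zero _ (h1 m))),
    count_roots_mul (mul_ne_zero hX hq) (pow_ne_zero _ (h1 m)), count_roots_mul hX hq,
    count_roots_prod _ _ fun j _ => h2 j, hcp, hcp fun j => M (m - (j + 1)), roots_pow,
    Multiset.count_nsmul, roots_X_sub_C] at hcount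
  change ((graphCharpoly _).roots.count z : ℤ) = _
  have hcount' := congrArg (Nat.cast : ℕ → ℤ) hcount
  -- Substituting for `M i`, the summands `(k + 1) k^i` cancel against the left side and only
  -- `sMult` remains.
  simp only [Nat.cast_add, Nat.cast_mul, Nat.cast_sum, hM] at hcount'
  simp only [add_mul, mul_add, Finset.sum_add_distrib, one_mul] at hcount' ⊢
  linarith

theorem mainTheorem1 (k : ℕ) (hk : 1 ≤ k) :
    -- initial value
    graphCharpoly (sierpinskiPP 1 k) = (X - C (k : ℂ)) * (X + 1) ^ k ∧
    -- the recursion, as an identity of rational functions (the exponent is `-1` if `k = 1`)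
    (∀ n : ℕ, 2 ≤ n →
      algebraMap ℂ[X] (RatFunc ℂ) (graphCharpoly (sierpinskiPP n k)) =
        algebraMap ℂ[X] (RatFunc ℂ) (X * (X + 2)) ^ sMult k (n - 2) *
          algebraMap ℂ[X] (RatFunc ℂ) ((graphCharpoly (sierpinskiPP (n - 1) k)).comp (fPoly k))) ∧
    -- the spectrum as a multiset, all zeros counted with multiplicity
    (∀ n : ℕ, 2 ≤ n → ∀ z : ℂ,
      (eigMult (sierpinskiPP n k) z : ℤ) =
        (({(k : ℂ)} : Multiset ℂ).count z : ℤ) +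
        (k : ℤ) * ((fIter k (n - 1) + 1).roots.count z : ℤ) +
        ∑ j ∈ Finset.range (n - 1), sMult k (n - 2 - j) * ((fIter k j).roots.count z : ℤ) +
        ∑ j ∈ Finset.range (n - 1),
          (sMult k (n - 2 - j) + 1) * ((fIter k j + 2).roots.count z : ℤ)) ∧
    -- for `k ≥ 3` the listed numbers are the exact multiplicities of the individual eigenvalues
    (3 ≤ k → ∀ n : ℕ, 2 ≤ n →
      eigMult (sierpinskiPP n k) (k : ℂ) = 1 ∧
      (∀ z : ℂ, (fIter k (n - 1)).eval z + 1 = 0 → eigMult (sierpinskiPP n k) z = k) ∧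
      (∀ j ≤ n - 2, ∀ z : ℂ, (fIter k j).eval z = 0 →
        (eigMult (sierpinskiPP n k) z : ℤ) = sMult k (n - 2 - j)) ∧
      (∀ j ≤ n - 2, ∀ z : ℂ, (fIter k j).eval z + 2 = 0 →
        (eigMult (sierpinskiPP n k) z : ℤ) = sMult k (n - 2 - j) + 1)) := by
  have spectrum : ∀ m : ℕ, ∀ z : ℂ, (eigMult (sierpinskiPP (m + 2) k) z : ℤ) =
      (({(k : ℂ)} : Multiset ℂ).count z : ℤ) +
      (k : ℤ) * ((fIter k (m + 1) + 1).roots.count z : ℤ) +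
      ∑ j ∈ Finset.range (m + 1), sMult k (m - j) * ((fIter k j).roots.count z : ℤ) +
      ∑ j ∈ Finset.range (m + 1),
        (sMult k (m - j) + 1) * ((fIter k j + 2).roots.count z : ℤ) := by
    intro m z
    rw [eigMult_sierpinskiPP k (m + 1) z]
    simp only [Nat.add_sub_add_right]
  refine ⟨graphCharpoly_sierpinskiPP_one k, ?_, ?_, ?_⟩
  · intro n hn
    obtain ⟨m, rfl⟩ := Nat.exists_eq_add_of_le' hn
    obtain ⟨M, hM, h⟩ := graphCharpoly_sierpinskiPP_succ m k
    have hc : algebraMap ℂ[X] (RatFunc ℂ) (X * (X + 2)) ≠ 0 := by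
      refine (map_ne_zero_iff _ (IsFractionRing.injective ℂ[X] (RatFunc ℂ))).2 ?_
      exact mul_ne_zero X_ne_zero (X_add_C_ne_zero (2 : ℂ))
    have h' := congrArg (algebraMap ℂ[X] (RatFunc ℂ)) h
    rw [map_mul, map_mul, map_pow, map_pow, ← zpow_natCast _ M, hM, zpow_add₀ hc, zpow_natCast,
      mul_right_comm] at h'
    exact mul_right_cancel₀ (pow_ne_zero _ hc) h'
  · intro n hn z
    obtain ⟨m, rfl⟩ := Nat.exists_eq_add_of_le' hn
    exact spectrum m z
  · intro hk3 n hn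
    classical
    obtain ⟨m, rfl⟩ := Nat.exists_eq_add_of_le' hn
    have c0 : ∀ j z, (fIter k j).roots.count z = if (fIter k j).eval z = 0 then 1 else 0 := by
      intro j z
      simpa using count_roots_fIter_add_C hk3 j (Or.inl rfl) z
    have c1 : ∀ j z, (fIter k j + 1).roots.count z =
        if (fIter k j).eval z + 1 = 0 then 1 else 0 := by
      intro j z
      simpa using count_roots_fIter_add_C hk3 j (Or.inr (Or.inl rfl)) z
    have c2 : ∀ j z, (fIter k j + 2).roots.count z =
        if (fIter k j).eval z + 2 = 0 then 1 else 0 := by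
      intro j z
      exact count_roots_fIter_add_C hk3 j (Or.inr (Or.inr rfl)) z
    have hkpos : ∀ d : ℕ, (k : ℂ) + d ≠ 0 := fun d => by
      have : k + d ≠ 0 := by omega
      exact_mod_cast this
    have hk0 : (k : ℂ) ≠ 0 := by simpa using hkpos 0
    have hk1 : (k : ℂ) + 1 ≠ 0 := by simpa using hkpos 1
    have hk2 : (k : ℂ) + 2 ≠ 0 := by simpa using hkpos 2
    have e0 : ∀ {i j z}, i < j → (fIter k i).eval z = 0 → ∀ {d : ℂ}, d = 0 ∨ d = 1 ∨ d = 2 →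
        (fIter k j).eval z + d ≠ 0 := fun hij h d hd =>
      eval_fIter_add_ne_zero_of_lt hk3 hij (Or.inl rfl) hd (by simpa using h)
    have e2 : ∀ {i j z}, i < j → (fIter k i).eval z + 2 = 0 → ∀ {d : ℂ}, d = 0 ∨ d = 1 ∨ d = 2 →
        (fIter k j).eval z + d ≠ 0 := fun hij h d hd =>
      eval_fIter_add_ne_zero_of_lt hk3 hij (Or.inr rfl) hd h
    -- A zero from items 3 or 4 (`c = 0` or `c = 2`) occurs nowhere else in the list, so each sum
    -- below has at most one nonzero term.
    have single : ∀ z, ∀ c : ℂ, c = 0 ∨ c = 2 → ∀ j ≤ m, (fIter k j).eval z + c = 0 →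
        z ≠ k ∧ (fIter k (m + 1)).eval z + 1 ≠ 0 ∧
        (∀ i < m + 1, (fIter k i).eval z = 0 → i = j ∧ c = 0) ∧
        ∀ i < m + 1, (fIter k i).eval z + 2 = 0 → i = j ∧ c = 2 := by
      intro z c hc j hj h
      have hcd : c = 0 ∨ c = 1 ∨ c = 2 := by tauto
      refine ⟨?_, ?_, ?_, ?_⟩
      · rintro rfl
        rw [eval_fIter_natCast] at h
        rcases hc with rfl | rfl
        · exact hk0 (by simpa using h)
        · exact hk2 h
      · exact eval_fIter_add_ne_zero_of_lt hk3 (Nat.lt_succ_of_le hj) hc (by simp) h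
      · intro i _ hi
        rcases lt_trichotomy i j with hij | rfl | hij
        · exact absurd h (e0 hij hi hcd)
        · exact ⟨rfl, by simpa [hi] using h⟩
        · exact absurd (by simpa using hi)
            (eval_fIter_add_ne_zero_of_lt hk3 hij hc (d := 0) (by simp) h)
      · intro i _ hi
        rcases lt_trichotomy i j with hij | rfl | hij
        · exact absurd h (e2 hij hi hcd)
        · exact ⟨rfl, add_left_cancel (h.trans hi.symm)⟩
        · exact absurd hi (eval_fIter_add_ne_zero_of_lt hk3 hij hc (by simp) h)
    refine ⟨?_, ?_, ?_, ?_⟩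
    -- `k` is a fixed point of `f`, so no `f^j`, `f^j + 1` or `f^j + 2` vanishes at it.
    · have := spectrum m k
      simp only [c0, c1, c2, eval_fIter_natCast, hk0, hk1, hk2, if_false] at this
      simpa using this
    · intro z hz
      have h := spectrum m z
      have hz' : (fIter k (m + 1)).eval z + 1 = 0 := hz
      have hzk : z ≠ k := by
        rintro rfl
        rw [eval_fIter_natCast] at hz'
        exact hk1 hz'
      simp only [c0, c1, c2] at h
      rw [Finset.sum_eq_zero, Finset.sum_eq_zero] at h
      · simpa [hz', hzk] using h
      · intro i hi
        rw [if_neg fun hi' => e2 (Finset.mem_range.1 hi) hi' (by simp) hz']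
        simp
      · intro i hi
        rw [if_neg fun hi' => e0 (Finset.mem_range.1 hi) hi' (by simp) hz']
        simp
    · intro j hj z hz
      rw [Nat.add_sub_cancel] at hj ⊢
      obtain ⟨hzk, hz1, s0, s2⟩ := single z 0 (Or.inl rfl) j hj (by simpa using hz)
      have h := spectrum m z
      simp only [c0, c1, c2] at h
      rw [Finset.sum_eq_single_of_mem j (Finset.mem_range.2 (Nat.lt_succ_of_le hj)),
        Finset.sum_eq_zero] at h
      · simpa [hz, hz1, hzk] using h
      · intro i hi
        rw [if_neg fun hi' => by simpa using (s2 i (Finset.mem_range.1 hi) hi').2]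
        simp
      · intro i hi hij
        rw [if_neg fun hi' => hij (s0 i (Finset.mem_range.1 hi) hi').1]
        simp
    · intro j hj z hz
      rw [Nat.add_sub_cancel] at hj ⊢
      obtain ⟨hzk, hz1, s0, s2⟩ := single z 2 (Or.inr rfl) j hj hz
      have h := spectrum m z
      simp only [c0, c1, c2] at h
      rw [Finset.sum_eq_zero,
        Finset.sum_eq_single_of_mem j (Finset.mem_range.2 (Nat.lt_succ_of_le hj))] at h
      · simpa [hz, hz1, hzk] using h
      · intro i hi hij
        rw [if_neg fun hi' => hij (s2 i (Finset.mem_range.1 hi) hi').1]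
        simp
      · intro i hi
        rw [if_neg fun hi' => by simpa using (s0 i (Finset.mem_range.1 hi) hi').2]
        simp
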